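/- For integers $n,m,k\ge 0$ let ${n \brace k}_{\le m}$ be the number of partitions of an $n$-element set into exactly $k$ nonempty blocks, each having at most $m$ elements, and let ${n \brack k}_{\le m}$ be the number of permutations of an $n$-element set with exactly $k$ cycles (fixed points counted as cycles of length $1$), each having at most $m$ elements. Define the restricted Bell numbers and the restricted factorial numbers by $$B_{n,\le m}=\sum_{k=0}^{n}{n \brace k}_{\le m},\qquad A_{n,\le m}=\sum_{k=0}^{n}{n \brack k}_{\le m}.$$ A sequence $(a_n)_{n\ge 0}$ of nonnegative real numbers is called log-concave if $a_na_{n+2}\le a_{n+1}^2$ for all $n\ge 0$, and log-convex if $a_na_{n+2}\ge a_{n+1}^2$ for all $n\ge 0$. **Theorem.** For every $m\ge 0$: 1. the sequence $(B_{n,\le m})_{n\ge 0}$ is log-convex and the sequence $(B_{n,\le m}/n!)_{n\ge 0}$ is log-concave; 2. the sequence $(A_{n,\le m})_{n\ge 0}$ is log-convex and the sequence $(A_{n,\le m}/n!)_{n\ge 0}$ is log-concave. -/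

import Mathlib

/-- Restricted Stirling number of the second kind: the number of partitions of an `n`-element set
into exactly `k` (nonempty) blocks, none of which has more than `m` elements. -/
def restrictedStirlingSecond (m n k : ℕ) : ℕ :=
  Fintype.card {P : Finpartition (Finset.univ : Finset (Fin n)) //
    P.parts.card = k ∧ ∀ b ∈ P.parts, b.card ≤ m}

/-- Restricted Bell number `B_{n,≤m}`. -/
def restrictedBell (m n : ℕ) : ℕ :=
  ∑ k ∈ Finset.range (n + 1), restrictedStirlingSecond m n k

/-- Restricted Stirling number of the first kind: the number of permutations of an `n`-element set
with exactly `k` cycles, none of which has more than `m` elements. Fixed points count as cycles of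
length one: `σ.partition` is the full cycle type, fixed points included. -/
def restrictedStirlingFirst (m n k : ℕ) : ℕ :=
  Fintype.card {σ : Equiv.Perm (Fin n) //
    σ.partition.parts.card = k ∧ ∀ c ∈ σ.partition.parts, c ≤ m}

/-- Restricted factorial number `A_{n,≤m}`. -/
def restrictedFactorial (m n : ℕ) : ℕ :=
  ∑ k ∈ Finset.range (n + 1), restrictedStirlingFirst m n k

/-- Log-concavity of a sequence of nonnegative real numbers. -/
def IsLogConcaveSeq (a : ℕ → ℝ) : Prop :=
  (∀ n, 0 ≤ a n) ∧ ∀ n, a n * a (n + 2) ≤ a (n + 1) ^ 2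

/-- Log-convexity of a sequence of nonnegative real numbers. -/
def IsLogConvexSeq (a : ℕ → ℝ) : Prop :=
  (∀ n, 0 ≤ a n) ∧ ∀ n, a (n + 1) ^ 2 ≤ a n * a (n + 2)

/-! Both exponential generating functions have the form `exp (∑ X j u ^ j / j)`: `X j = 1 / (j -
1)!` for set partitions and `X j = 1` for permutations, cut off after `j = m`, with `X 0 = 1` added.
Both `X` have decreasing ratios, so the Bender-Canfield theorem applies to the coefficients `A`.

That theorem needs only the recurrence obtained by differentiating the exponential. Log-concavity of
`A` comes by strong induction from a Cauchy-Binet inequality (`sum_mul_sum_le_of_cross_mul_le`)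
applied to shifts of `X` and of `A`. Log-convexity of `n! * A n` then follows by comparing two
recurrences term by term.

The recurrences are proved combinatorially: `restrictedBell_succ` by the block of a chosen element,
`boundedCycleWeight_rec` by removing a part from a cycle type. -/

open Finset in
/-- A two-column form of the Cauchy-Binet inequality for sequences ordered oppositely by ratio. -/
theorem sum_mul_sum_le_of_cross_mul_le (N : ℕ) (x y u v : ℕ → ℝ)
    (hxy : ∀ i j, i ≤ j → x i * y j ≤ y i * x j)
    (huv : ∀ i j, i ≤ j → u i * v j ≤ u j * v i) :
    (∑ i ∈ range N, y i * u i) * (∑ i ∈ range N, x i * v i) ≤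
      (∑ i ∈ range N, x i * u i) * (∑ i ∈ range N, y i * v i) := by
  -- Both factors change sign together when `i` and `j` swap; the double sum is twice the desired
  -- difference.
  have key : 0 ≤ ∑ i ∈ range N, ∑ j ∈ range N,
      (x i * y j - y i * x j) * (u i * v j - u j * v i) := by
    refine sum_nonneg fun i _ => sum_nonneg fun j _ => ?_
    rcases le_total i j with h | h
    · exact mul_nonneg_of_nonpos_of_nonpos (by linarith [hxy i j h]) (by linarith [huv i j h])
    · exact mul_nonneg (by linarith [hxy j i h]) (by linarith [huv j i h])
  have e1 : ∑ i ∈ range N, ∑ j ∈ range N, (x i * y j - y i * x j) * (u i * v j - u j * v i) =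
      (∑ i ∈ range N, ∑ j ∈ range N, (x i * u i) * (y j * v j)
        - ∑ i ∈ range N, ∑ j ∈ range N, (y i * u i) * (x j * v j))
      + (∑ i ∈ range N, ∑ j ∈ range N, (y i * v i) * (x j * u j)
        - ∑ i ∈ range N, ∑ j ∈ range N, (x i * v i) * (y j * u j)) := by
    simp only [← sum_sub_distrib, ← sum_add_distrib]
    refine sum_congr rfl fun i _ => sum_congr rfl fun j _ => ?_
    ring
  simp only [← sum_mul_sum] at e1
  nlinarith

/-- If log-concavity holds below `n` for a positive sequence, then consecutive ratios decrease. -/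
theorem mul_succ_le_succ_mul_of_logConcave (A : ℕ → ℝ) (hA : ∀ n, 0 < A n) (n : ℕ)
    (h : ∀ c < n, A c * A (c + 2) ≤ A (c + 1) ^ 2) (a b : ℕ) (hab : a ≤ b) (hb : b ≤ n) :
    A a * A (b + 1) ≤ A (a + 1) * A b := by
  induction b, hab using Nat.le_induction with
  | base => rw [mul_comm]
  | succ b hab ih =>
    have h1 := ih (by omega)
    have h2 := h b (by omega)
    refine le_of_mul_le_mul_right ?_ (mul_pos (hA b) (hA (b + 1)))
    calc A a * A (b + 1 + 1) * (A b * A (b + 1))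
        = (A a * A (b + 1)) * (A b * A (b + 2)) := by ring
      _ ≤ (A (a + 1) * A b) * (A (b + 1) ^ 2) :=
          mul_le_mul h1 h2 (mul_pos (hA _) (hA _)).le (mul_pos (hA _) (hA _)).le
      _ = A (a + 1) * A (b + 1) * (A b * A (b + 1)) := by ring

/-! ### The Bender-Canfield theorem -/

section BenderCanfield

variable {X A : ℕ → ℝ}

open Finset in
theorem pos_of_exp_recurrence (hX : ∀ j, 0 ≤ X j) (hX1 : 0 < X 1) (hA0 : 0 < A 0)
    (hrec : ∀ n : ℕ, (n + 1 : ℝ) * A (n + 1) = ∑ j ∈ range (n + 1), X (j + 1) * A (n - j))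
    (n : ℕ) : 0 < A n := by
  induction n using Nat.strong_induction_on with
  | _ n ih =>
    rcases n with _ | n
    · exact hA0
    have : 0 < (n + 1 : ℝ) * A (n + 1) := by
      rw [hrec]
      refine sum_pos' (fun j _ => mul_nonneg (hX _) (ih _ (by omega)).le)
        ⟨0, by simp, mul_pos hX1 (ih _ (by omega))⟩
    exact pos_of_mul_pos_right this (by positivity)

-- Cauchy-Binet for the rows `X i`, `X (i + 1)` against `A (n + 1 - i)`, `A (n - i)`: the recurrence
-- evaluates all four sums, and the factor `(n + 2) * (n + 1)` appears on both sides. Ordering the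
-- `A` ratios needs log-concavity only below `n`.
open Finset in
theorem logConcave_of_exp_recurrence_of_pos (hX : ∀ j, 0 ≤ X j) (hX0 : X 0 = 1) (hX1 : 0 < X 1)
    (hlc : ∀ i j, i ≤ j → X i * X (j + 1) ≤ X (i + 1) * X j) (hA0 : 0 < A 0)
    (hrec : ∀ n : ℕ, (n + 1 : ℝ) * A (n + 1) = ∑ j ∈ range (n + 1), X (j + 1) * A (n - j))
    (n : ℕ) : A n * A (n + 2) ≤ A (n + 1) ^ 2 := by
  have hpos := pos_of_exp_recurrence hX hX1 hA0 hrec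
  induction n using Nat.strong_induction_on with
  | _ n ih =>
    have hr := mul_succ_le_succ_mul_of_logConcave A hpos n ih
    set u : ℕ → ℝ := fun j => if j ≤ n + 1 then A (n + 1 - j) else 0 with hu
    set v : ℕ → ℝ := fun j => if j ≤ n then A (n - j) else 0 with hv
    have huv : ∀ i j, i ≤ j → u i * v j ≤ u j * v i := by
      intro i j hij
      by_cases hj : j ≤ n
      · have := hr (n - j) (n - i) (by omega) (by omega)
        simp only [hu, hv, if_pos hj, if_pos (hij.trans hj), if_pos (show i ≤ n + 1 by omega),
          if_pos (show j ≤ n + 1 by omega)]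
        rw [show n + 1 - i = n - i + 1 by omega, show n + 1 - j = n - j + 1 by omega]
        linarith
      · have hvj : v j = 0 := by simp [hv, hj]
        rw [hvj, mul_zero]
        refine mul_nonneg ?_ ?_
        · simp only [hu]; split_ifs <;> first | exact (hpos _).le | exact le_rfl
        · simp only [hv]; split_ifs <;> first | exact (hpos _).le | exact le_rfl
    have key := sum_mul_sum_le_of_cross_mul_le (n + 2) X (fun j => X (j + 1)) u v hlc huv
    have hyu : ∑ i ∈ range (n + 2), X (i + 1) * u i = (n + 2) * A (n + 2) := by
      have := hrec (n + 1)
      push_cast at this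
      rw [show (n : ℝ) + 2 = n + 1 + 1 by ring, this]
      refine sum_congr rfl fun j hj => ?_
      have := mem_range.1 hj
      simp [hu, show j ≤ n + 1 by omega]
    have hyv : ∑ i ∈ range (n + 2), X (i + 1) * v i = (n + 1) * A (n + 1) := by
      rw [hrec n, sum_range_succ, show v (n + 1) = 0 by simp [hv], mul_zero, add_zero]
      refine sum_congr rfl fun j hj => ?_
      have := mem_range.1 hj
      simp [hv, show j ≤ n by omega]
    -- The term `X 0 = 1` contributes one more `A (n + 1)`, raising the factor from `n + 1` to `n +
    -- 2`.
    have hxu : ∑ i ∈ range (n + 2), X i * u i = (n + 2) * A (n + 1) := by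
      rw [sum_range_succ']
      have : ∑ i ∈ range (n + 1), X (i + 1) * u (i + 1) = (n + 1) * A (n + 1) := by
        rw [hrec n]
        refine sum_congr rfl fun j hj => ?_
        have := mem_range.1 hj
        simp [hu, show j ≤ n by omega]
      rw [this, hX0]
      simp [hu]
      ring
    have hxv : ∑ i ∈ range (n + 2), X i * v i = (n + 1) * A n := by
      rw [sum_range_succ, show v (n + 1) = 0 by simp [hv], mul_zero, add_zero, sum_range_succ',
        hX0, show v 0 = A n by simp [hv]]
      have : ∑ i ∈ range n, X (i + 1) * v (i + 1) = n * A n := by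
        rcases n with _ | n
        · simp
        push_cast
        rw [hrec n]
        refine sum_congr rfl fun j hj => ?_
        have := mem_range.1 hj
        simp [hv, show j ≤ n by omega]
      rw [this]
      ring
    rw [hyu, hxv, hxu, hyv] at key
    have hp : (0 : ℝ) < (n + 2) * (n + 1) := by positivity
    refine le_of_mul_le_mul_left ?_ hp
    linarith

/-- If `X 1 = 0` then the sequence vanishes at positive indices. -/
theorem eq_zero_of_exp_recurrence (hX : ∀ j, 0 ≤ X j) (hX0 : X 0 = 1) (hX1 : X 1 = 0)
    (hlc : ∀ i j, i ≤ j → X i * X (j + 1) ≤ X (i + 1) * X j)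
    (hrec : ∀ n : ℕ, (n + 1 : ℝ) * A (n + 1) =
      ∑ j ∈ Finset.range (n + 1), X (j + 1) * A (n - j)) (n : ℕ) : A (n + 1) = 0 := by
  have hz : ∀ j, X (j + 1) = 0 := fun j => by
    have := hlc 0 j (Nat.zero_le _)
    rw [hX0, hX1] at this
    linarith [hX (j + 1)]
  have := hrec n
  simp only [hz, zero_mul, Finset.sum_const_zero, mul_eq_zero] at this
  exact this.resolve_left (by positivity)

/-- Bender-Canfield: if `∑ A n u ^ n = exp (∑ X j u ^ j / j)` with `X` log-concave and `X 0 = 1`,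
then `A` is log-concave. -/
theorem isLogConcaveSeq_of_exp_recurrence (hX : ∀ j, 0 ≤ X j) (hX0 : X 0 = 1)
    (hlc : ∀ i j, i ≤ j → X i * X (j + 1) ≤ X (i + 1) * X j) (hA0 : 0 < A 0)
    (hrec : ∀ n : ℕ, (n + 1 : ℝ) * A (n + 1) =
      ∑ j ∈ Finset.range (n + 1), X (j + 1) * A (n - j)) : IsLogConcaveSeq A := by
  rcases (hX 1).lt_or_eq with h | h
  · exact ⟨fun n => (pos_of_exp_recurrence hX h hA0 hrec n).le,
      logConcave_of_exp_recurrence_of_pos hX hX0 h hlc hA0 hrec⟩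
  · have hz := eq_zero_of_exp_recurrence hX hX0 h.symm hlc hrec
    refine ⟨fun n => ?_, fun n => by simp [hz]⟩
    rcases n with _ | n
    · exact hA0.le
    · exact (hz n).ge

open Finset in
/-- Bender-Canfield: if `∑ A n u ^ n = exp (∑ X j u ^ j / j)` with `X` log-concave and `X 0 = 1`,
then `n! * A n` is log-convex. -/
theorem isLogConvexSeq_of_exp_recurrence (hX : ∀ j, 0 ≤ X j) (hX0 : X 0 = 1)
    (hlc : ∀ i j, i ≤ j → X i * X (j + 1) ≤ X (i + 1) * X j) (hA0 : 0 < A 0)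
    (hrec : ∀ n : ℕ, (n + 1 : ℝ) * A (n + 1) = ∑ j ∈ range (n + 1), X (j + 1) * A (n - j)) :
    IsLogConvexSeq (fun n => (n.factorial : ℝ) * A n) := by
  refine ⟨fun n => mul_nonneg (by positivity)
    ((isLogConcaveSeq_of_exp_recurrence hX hX0 hlc hA0 hrec).1 n), fun n => ?_⟩
  rcases (hX 1).lt_or_eq with h | h
  · have hpos := pos_of_exp_recurrence hX h hA0 hrec
    have hr := mul_succ_le_succ_mul_of_logConcave A hpos n fun c _ =>
      logConcave_of_exp_recurrence_of_pos hX hX0 h hlc hA0 hrec c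
    have key : A (n + 1) * ((n + 1) * A (n + 1)) ≤ A n * ((n + 2) * A (n + 2)) := by
      have h2 := hrec (n + 1)
      push_cast at h2
      rw [show (n : ℝ) + 2 = n + 1 + 1 by ring, h2, hrec n, sum_range_succ _ (n + 1), mul_add,
        mul_sum, mul_sum]
      -- Decreasing ratios compare the terms `j ≤ n`; the extra term `j = n + 1` is nonnegative and
      -- dropped.
      refine le_add_of_le_of_nonneg (sum_le_sum fun j hj => ?_)
        (mul_nonneg (hpos _).le (mul_nonneg (hX _) (hpos _).le))
      have := mem_range.1 hj
      have h3 := mul_le_mul_of_nonneg_left (hr (n - j) n (by omega) le_rfl) (hX (j + 1))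
      rw [show n + 1 - j = n - j + 1 by omega]
      linarith
    simp only [Nat.factorial_succ]
    push_cast
    have h4 := mul_le_mul_of_nonneg_left key
      (show (0 : ℝ) ≤ (n.factorial : ℝ) ^ 2 * (n + 1) by positivity)
    linarith
  · have hz := eq_zero_of_exp_recurrence hX hX0 h.symm hlc hrec
    simp [hz]

end BenderCanfield
-- Recurrence for restricted Bell numbers
/-- The number of partitions of the finite set `s` with all blocks of size at most `m`. -/
def boundedFinpartitionCount {α : Type} [DecidableEq α] (m : ℕ) (s : Finset α) : ℕ :=
  (Finset.univ.filter fun P : Finpartition s => ∀ b ∈ P.parts, b.card ≤ m).card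

open Finset in
theorem restrictedBell_eq_boundedFinpartitionCount (m n : ℕ) :
    restrictedBell m n = boundedFinpartitionCount m (univ : Finset (Fin n)) := by
  unfold restrictedBell restrictedStirlingSecond boundedFinpartitionCount
  rw [card_eq_sum_card_fiberwise (f := fun P => P.parts.card) (t := range (n + 1))]
  · refine sum_congr rfl fun k _ => ?_
    rw [Fintype.card_subtype, filter_filter]
    congr 1
    ext P
    simp [and_comm]
  · intro P _
    have := P.card_parts_le_card
    simp only [card_univ, Fintype.card_fin] at this
    simpa using Nat.lt_succ_of_le this

open Finset in
theorem card_boundedFinpartition_with_block {α : Type} [DecidableEq α] (m : ℕ) {s b : Finset α}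
    (hb : b.Nonempty) (hbs : b ⊆ s) (hbm : b.card ≤ m) :
    (univ.filter fun P : Finpartition s => (∀ c ∈ P.parts, c.card ≤ m) ∧ b ∈ P.parts).card =
      boundedFinpartitionCount m (s \ b) := by
  have hdis : ∀ P : Finpartition s, b ∈ P.parts → (P.parts.erase b).sup id = s \ b := by
    intro P hP
    ext x
    simp only [mem_sup, mem_erase, id, mem_sdiff]
    constructor
    · rintro ⟨c, ⟨hcb, hc⟩, hx⟩
      exact ⟨P.subset hc hx, fun hxb => hcb (P.eq_of_mem_parts hc hP hx hxb)⟩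
    · rintro ⟨hx, hxb⟩
      obtain ⟨c, hc, hxc⟩ := P.exists_mem hx
      exact ⟨c, ⟨fun h => hxb (h ▸ hxc), hc⟩, hxc⟩
  refine card_bij'
    (fun P hP => P.ofSubset (erase_subset b P.parts) (hdis P (by simpa using (mem_filter.1 hP).2.2)))
    (fun Q _ => Q.extend (b := b) (c := s) hb.ne_empty disjoint_sdiff_self_left
      (by simpa using hbs)) ?_ ?_ ?_ ?_
  · intro P hP
    simp only [mem_filter, mem_univ, true_and] at hP ⊢
    intro c hc
    exact hP.1 c (erase_subset _ _ hc)
  · intro Q hQ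
    simp only [mem_filter, mem_univ, true_and] at hQ ⊢
    simp only [Finpartition.extend_parts, mem_insert, true_or, and_true]
    rintro c (rfl | hc)
    · exact hbm
    · exact hQ c hc
  · intro P hP
    simp only [mem_filter, mem_univ, true_and] at hP
    ext1
    simp [insert_erase hP.2]
  · intro Q hQ
    ext1
    simp only [Finpartition.extend_parts, Finpartition.ofSubset_parts]
    refine erase_insert fun h => ?_
    obtain ⟨x, hx⟩ := hb
    exact (mem_sdiff.1 (Q.subset h hx)).2 hx

-- Partitions are sorted by the block of `a`, written `insert a t`; deleting it leaves a partition
-- of `u \ t`.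
open Finset in
theorem boundedFinpartitionCount_insert {α : Type} [DecidableEq α] (m : ℕ) {a : α} {u : Finset α}
    (ha : a ∉ u) :
    boundedFinpartitionCount m (insert a u) =
      ∑ t ∈ u.powerset, if t.card + 1 ≤ m then boundedFinpartitionCount m (u \ t) else 0 := by
  have hmem : ∀ P : Finpartition (insert a u), a ∈ P.part a := fun P =>
    P.mem_part_self.2 (mem_insert_self _ _)
  have hpart : ∀ P : Finpartition (insert a u), P.part a ∈ P.parts := fun P =>
    P.part_mem.2 (mem_insert_self _ _)
  conv_lhs => unfold boundedFinpartitionCount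
  rw [card_eq_sum_card_fiberwise (f := fun P => (P.part a).erase a) (t := u.powerset)]
  · refine sum_congr rfl fun t ht => ?_
    have htu := mem_powerset.1 ht
    have hat : a ∉ t := fun h => ha (htu h)
    rw [filter_filter]
    have hiff : ∀ P : Finpartition (insert a u), (P.part a).erase a = t ↔ insert a t ∈ P.parts := by
      intro P
      constructor
      · rintro rfl
        rw [insert_erase (hmem P)]
        exact hpart P
      · intro h
        rw [P.part_eq_of_mem h (mem_insert_self _ _), erase_insert hat]
    simp only [hiff]
    split_ifs with htm
    · have hset : insert a u \ insert a t = u \ t := by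
        ext x
        simp only [mem_sdiff, mem_insert]
        constructor
        · rintro ⟨h1 | h1, h2⟩
          · exact absurd (Or.inl h1) h2
          · exact ⟨h1, fun h => h2 (Or.inr h)⟩
        · rintro ⟨h1, h2⟩
          exact ⟨Or.inr h1, fun h => h.elim (fun h => ha (h ▸ h1)) h2⟩
      rw [← hset]
      exact card_boundedFinpartition_with_block m (insert_nonempty _ _)
        (insert_subset_insert _ htu) (by rwa [card_insert_of_notMem hat])
    · rw [card_eq_zero, filter_eq_empty_iff]
      rintro P - ⟨h1, h2⟩
      have := h1 _ h2
      rw [card_insert_of_notMem hat] at this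
      exact htm this
  · intro P _
    simp only [coe_powerset, Set.mem_preimage, Set.mem_powerset_iff, coe_subset]
    rw [← subset_insert_iff]
    exact P.part_subset a

open Finset in
theorem boundedFinpartitionCount_empty {α : Type} [DecidableEq α] (m : ℕ) :
    boundedFinpartitionCount m (∅ : Finset α) = 1 := by
  have hP : ∀ P : Finpartition (∅ : Finset α), P.parts = ∅ := fun P =>
    P.parts_eq_empty_iff.2 rfl
  unfold boundedFinpartitionCount
  rw [filter_true_of_mem (fun P _ => by simp [hP P])]
  refine card_eq_one.2 ⟨Finpartition.empty _, ?_⟩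
  ext P
  simp only [mem_univ, mem_singleton, true_iff]
  ext1
  rw [hP, hP]

-- The complements `u \ t` are not of the form `Fin n`, so the induction runs over all finite sets
-- and proves the recurrence together with dependence on cardinality alone.
open Finset in
theorem boundedFinpartitionCount_eq_restrictedBell (m n : ℕ) :
    ∀ {α : Type} [DecidableEq α] (s : Finset α), s.card = n →
      boundedFinpartitionCount m s = restrictedBell m n ∧
      ∀ k, n = k + 1 → boundedFinpartitionCount m s = ∑ j ∈ range (k + 1),
        k.choose j * if j + 1 ≤ m then restrictedBell m (k - j) else 0 := by
  induction n using Nat.strong_induction_on with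
  | _ n ih =>
    rcases n with _ | k
    · intro α _ s hs
      obtain rfl := card_eq_zero.1 hs
      refine ⟨?_, fun k hk => by omega⟩
      rw [restrictedBell_eq_boundedFinpartitionCount]
      rw [boundedFinpartitionCount_empty, univ_eq_empty, boundedFinpartitionCount_empty]
    · have hsum : ∀ {α : Type} [DecidableEq α] (s : Finset α), s.card = k + 1 →
          boundedFinpartitionCount m s = ∑ j ∈ range (k + 1),
            k.choose j * if j + 1 ≤ m then restrictedBell m (k - j) else 0 := by
        intro α _ s hs
        obtain ⟨a, u, hau, rfl, hu⟩ := card_eq_succ.1 hs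
        rw [boundedFinpartitionCount_insert m hau]
        have hpow := sum_powerset_apply_card (x := u)
          (fun j => if j + 1 ≤ m then restrictedBell m (k - j) else 0)
        simp only [hu, smul_eq_mul] at hpow
        rw [← hpow]
        refine sum_congr rfl fun t ht => ?_
        have htu := mem_powerset.1 ht
        have hcard : (u \ t).card = k - t.card := by rw [card_sdiff_of_subset htu, hu]
        rw [(ih (k - t.card) (by omega) (u \ t) hcard).1]
      intro α _ s hs
      refine ⟨?_, fun k' hk => ?_⟩
      · rw [hsum s hs, restrictedBell_eq_boundedFinpartitionCount, hsum univ (by simp)]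
      · obtain rfl : k = k' := by omega
        exact hsum s hs

theorem restrictedBell_zero_right (m : ℕ) : restrictedBell m 0 = 1 := by
  rw [restrictedBell_eq_boundedFinpartitionCount, Finset.univ_eq_empty,
    boundedFinpartitionCount_empty]

theorem restrictedBell_succ (m n : ℕ) :
    restrictedBell m (n + 1) = ∑ j ∈ Finset.range (n + 1),
      n.choose j * if j + 1 ≤ m then restrictedBell m (n - j) else 0 := by
  rw [restrictedBell_eq_boundedFinpartitionCount]
  exact (boundedFinpartitionCount_eq_restrictedBell m (n + 1) _ (by simp)).2 n rfl
-- Recurrence for restricted factorial numbers via cycle types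
/-- The product `∏ j ^ c_j * c_j!` over a multiset in which `j` occurs `c_j` times: the order of the
centralizer of a permutation with that full cycle type. -/
def centralizerOrder (s : Multiset ℕ) : ℕ :=
  s.prod * ∏ j ∈ s.toFinset, (s.count j).factorial

open Finset in
theorem prod_factorial_count_of_subset (s : Multiset ℕ) {T : Finset ℕ} (hT : s.toFinset ⊆ T) :
    ∏ j ∈ s.toFinset, (s.count j).factorial = ∏ j ∈ T, (s.count j).factorial := by
  refine prod_subset hT fun j _ hj => ?_
  rw [Multiset.count_eq_zero_of_notMem (by simpa using hj), Nat.factorial_zero]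

open Finset in
theorem centralizerOrder_cons (j : ℕ) (t : Multiset ℕ) :
    centralizerOrder (j ::ₘ t) = j * (j ::ₘ t).count j * centralizerOrder t := by
  unfold centralizerOrder
  have h1 : t.toFinset ⊆ (j ::ₘ t).toFinset := by
    rw [Multiset.toFinset_cons]
    exact subset_insert _ _
  have hj : j ∈ (j ::ₘ t).toFinset := by simp
  rw [prod_factorial_count_of_subset t h1, ← mul_prod_erase _ _ hj,
    ← mul_prod_erase _ (fun i => (t.count i).factorial) hj, Multiset.prod_cons,
    Multiset.count_cons_self, Nat.factorial_succ]
  have : ∏ i ∈ (j ::ₘ t).toFinset.erase j, ((j ::ₘ t).count i).factorial =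
      ∏ i ∈ (j ::ₘ t).toFinset.erase j, (t.count i).factorial :=
    prod_congr rfl fun i hi => by rw [Multiset.count_cons_of_ne (ne_of_mem_erase hi)]
  rw [this]
  ring

theorem centralizerOrder_pos {s : Multiset ℕ} (hs : ∀ i ∈ s, 0 < i) : 0 < centralizerOrder s :=
  Nat.mul_pos (Multiset.prod_pos hs) (Finset.prod_pos fun _ _ => Nat.factorial_pos _)

open Finset in
theorem centralizerOrder_add_replicate_one (t : Multiset ℕ) (ht : ∀ a ∈ t, 2 ≤ a) (k : ℕ) :
    centralizerOrder (t + Multiset.replicate k 1) =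
      k.factorial * t.prod * ∏ j ∈ t.toFinset, (t.count j).factorial := by
  have h1 : 1 ∉ t := fun h => by have := ht 1 h; omega
  have hsub : (t + Multiset.replicate k 1).toFinset ⊆ insert 1 t.toFinset := by
    intro x hx
    simp only [Multiset.mem_toFinset, Multiset.mem_add, mem_insert] at hx ⊢
    rcases hx with hx | hx
    · exact Or.inr hx
    · exact Or.inl (Multiset.eq_of_mem_replicate hx)
  unfold centralizerOrder
  rw [prod_factorial_count_of_subset _ hsub, prod_insert (by simpa using h1)]
  have : ∏ i ∈ t.toFinset, ((t + Multiset.replicate k 1).count i).factorial =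
      ∏ i ∈ t.toFinset, (t.count i).factorial :=
    prod_congr rfl fun i hi => by
      have : i ≠ 1 := by
        rintro rfl
        exact h1 (by simpa using hi)
      rw [Multiset.count_add, Multiset.count_replicate, if_neg (Ne.symm this), add_zero]
  rw [this, Multiset.count_add, Multiset.count_eq_zero_of_notMem h1, Multiset.count_replicate_self,
    Multiset.prod_add, Multiset.prod_replicate, one_pow, zero_add]
  ring

theorem Nat.Partition.parts_eq_filter_add_replicate {n : ℕ} (p : n.Partition) :
    p.parts = p.parts.filter (2 ≤ ·) +
      Multiset.replicate (n - (p.parts.filter (2 ≤ ·)).sum) 1 := by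
  have h1 : p.parts.filter (fun i => ¬ 2 ≤ i) =
      Multiset.replicate (p.parts.filter (fun i => ¬ 2 ≤ i)).card 1 := by
    rw [Multiset.eq_replicate_card]
    intro b hb
    have := Multiset.mem_filter.1 hb
    have := p.parts_pos this.1
    omega
  have h2 := Multiset.filter_add_not (2 ≤ ·) p.parts
  have h3 : (p.parts.filter (2 ≤ ·)).sum + (p.parts.filter (fun i => ¬ 2 ≤ i)).sum = n := by
    rw [← Multiset.sum_add, h2, p.parts_sum]
  have h4 : (p.parts.filter (fun i => ¬ 2 ≤ i)).sum =
      (p.parts.filter (fun i => ¬ 2 ≤ i)).card := by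
    conv_lhs => rw [h1]
    simp
  rw [show n - (p.parts.filter (2 ≤ ·)).sum = (p.parts.filter (fun i => ¬ 2 ≤ i)).card by omega,
    ← h1, h2]

-- The conjugacy class formula. `cycleType` omits fixed points, but their number is forced by the
-- total size.
open Finset in
theorem card_perm_partition_eq_mul_centralizerOrder {α : Type} [Fintype α] [DecidableEq α]
    (p : (Fintype.card α).Partition) :
    (univ.filter fun σ : Equiv.Perm α => σ.partition = p).card * centralizerOrder p.parts =
      (Fintype.card α).factorial := by
  have hiff : ∀ σ : Equiv.Perm α,
      σ.partition = p ↔ σ.cycleType = p.parts.filter (2 ≤ ·) := by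
    intro σ
    constructor
    · rintro rfl
      exact Equiv.Perm.filter_parts_partition_eq_cycleType.symm
    · intro h
      ext1
      rw [p.parts_eq_filter_add_replicate, Equiv.Perm.parts_partition, ← Equiv.Perm.sum_cycleType,
        h]
  simp only [hiff]
  have ht : ∀ a ∈ p.parts.filter (2 ≤ ·), 2 ≤ a := fun a ha => (Multiset.mem_filter.1 ha).2
  have hsum : (p.parts.filter (2 ≤ ·)).sum ≤ Fintype.card α := by
    conv_rhs => rw [← p.parts_sum, ← Multiset.filter_add_not (2 ≤ ·) p.parts, Multiset.sum_add]
    exact Nat.le_add_right _ _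
  have hz := congrArg centralizerOrder p.parts_eq_filter_add_replicate
  rw [centralizerOrder_add_replicate_one _ ht] at hz
  rw [hz]
  have := Equiv.Perm.card_of_cycleType_mul_eq α (p.parts.filter (2 ≤ ·))
  rw [if_pos ⟨hsum, ht⟩] at this
  rw [← this]

/-- The proportion of permutations of an `n`-element set with all cycles of length at most `m`,
as a sum over cycle types. -/
noncomputable def boundedCycleWeight (m n : ℕ) : ℝ :=
  ∑ p : n.Partition with ∀ c ∈ p.parts, c ≤ m, ((centralizerOrder p.parts : ℝ))⁻¹

open Finset in
theorem restrictedFactorial_eq_card (m n : ℕ) :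
    restrictedFactorial m n =
      (univ.filter fun σ : Equiv.Perm (Fin n) => ∀ c ∈ σ.partition.parts, c ≤ m).card := by
  unfold restrictedFactorial restrictedStirlingFirst
  rw [card_eq_sum_card_fiberwise (f := fun σ => σ.partition.parts.card) (t := range (n + 1))]
  · refine sum_congr rfl fun k _ => ?_
    rw [Fintype.card_subtype, filter_filter]
    congr 1
    ext P
    simp [and_comm]
  · intro σ _
    have := Multiset.card_nsmul_le_sum (s := σ.partition.parts) (a := 1)
      fun x hx => σ.partition.parts_pos hx
    have h := this.trans (σ.partition.parts_sum.trans (Fintype.card_fin n)).le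
    simpa using Nat.lt_succ_of_le h

open Finset in
theorem card_perm_bounded_partition {α : Type} [Fintype α] [DecidableEq α] (m : ℕ) :
    ((univ.filter fun σ : Equiv.Perm α => ∀ c ∈ σ.partition.parts, c ≤ m).card : ℝ) =
      (Fintype.card α).factorial * boundedCycleWeight m (Fintype.card α) := by
  rw [card_eq_sum_card_fiberwise (f := fun σ : Equiv.Perm α => σ.partition)
    (t := univ.filter fun p : (Fintype.card α).Partition => ∀ c ∈ p.parts, c ≤ m)]
  · rw [boundedCycleWeight, mul_sum]
    push_cast
    refine sum_congr rfl fun p hp => ?_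
    have hp := (mem_filter.1 hp).2
    have hpos : (0 : ℝ) < centralizerOrder p.parts := by
      exact_mod_cast centralizerOrder_pos fun i hi => p.parts_pos hi
    rw [eq_mul_inv_iff_mul_eq₀ hpos.ne', ← card_perm_partition_eq_mul_centralizerOrder p,
      filter_filter]
    push_cast
    congr 3
    ext σ
    simp only [mem_filter, mem_univ, true_and, and_iff_right_iff_imp]
    rintro rfl
    exact hp
  · intro σ hσ
    simpa using hσ

theorem restrictedFactorial_eq (m n : ℕ) :
    (restrictedFactorial m n : ℝ) = n.factorial * boundedCycleWeight m n := by
  rw [restrictedFactorial_eq_card, card_perm_bounded_partition, Fintype.card_fin]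

theorem boundedCycleWeight_zero (m : ℕ) : boundedCycleWeight m 0 = 1 := by
  simp [boundedCycleWeight, centralizerOrder]

open Finset in
theorem sum_inv_centralizerOrder_erase (m n i : ℕ) (hi : i ≤ n) :
    ∑ p : (n + 1).Partition with (∀ c ∈ p.parts, c ≤ m) ∧ i + 1 ∈ p.parts,
      ((centralizerOrder (p.parts.erase (i + 1)) : ℝ))⁻¹ =
    if i + 1 ≤ m then boundedCycleWeight m (n - i) else 0 := by
  split_ifs with him
  · unfold boundedCycleWeight
    refine sum_bij'
      (fun p hp => (⟨p.parts.erase (i + 1), fun hj => p.parts_pos (Multiset.mem_of_mem_erase hj), by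
        have h := Multiset.sum_erase (mem_filter.1 hp).2.2
        rw [p.parts_sum] at h
        omega⟩ : (n - i).Partition))
      (fun q _ => (⟨(i + 1) ::ₘ q.parts, fun hj => by
        rcases Multiset.mem_cons.1 hj with rfl | hj
        · omega
        · exact q.parts_pos hj, by
        rw [Multiset.sum_cons, q.parts_sum]
        omega⟩ : (n + 1).Partition)) ?_ ?_ ?_ ?_ ?_
    · intro p hp
      simp only [mem_filter, mem_univ, true_and] at hp ⊢
      exact fun c hc => hp.1 c (Multiset.mem_of_mem_erase hc)
    · intro q hq
      simp only [mem_filter, mem_univ, true_and] at hq ⊢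
      refine ⟨fun c hc => ?_, Multiset.mem_cons_self _ _⟩
      rcases Multiset.mem_cons.1 hc with rfl | hc
      · exact him
      · exact hq c hc
    · intro p hp
      ext1
      exact Multiset.cons_erase (mem_filter.1 hp).2.2
    · intro q _
      ext1
      exact Multiset.erase_cons_head _ _
    · intro p _
      rfl
  · refine sum_eq_zero fun p hp => ?_
    have := (mem_filter.1 hp).2
    exact absurd (this.1 _ this.2) him

-- Write `n + 1` as the sum of part sizes times multiplicities. By `centralizerOrder_cons`, size
-- times multiplicity cancels exactly when one copy of that part is erased.
open Finset in
theorem boundedCycleWeight_rec (m n : ℕ) :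
    (n + 1 : ℝ) * boundedCycleWeight m (n + 1) =
      ∑ i ∈ range (n + 1), if i + 1 ≤ m then boundedCycleWeight m (n - i) else 0 := by
  have hsize : ∀ p : (n + 1).Partition,
      (n + 1 : ℝ) = ∑ i ∈ range (n + 1), ((i : ℝ) + 1) * p.parts.count (i + 1) := by
    intro p
    have h := sum_multiset_count_of_subset p.parts (range (n + 2)) fun j hj => by
      have := Nat.Partition.le_of_mem_parts (Multiset.mem_toFinset.1 hj)
      simp only [mem_range]
      omega
    rw [p.parts_sum, sum_range_succ'] at h
    simp only [smul_eq_mul, mul_zero, add_zero] at h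
    have h' := congrArg (Nat.cast : ℕ → ℝ) h
    push_cast at h'
    rw [h']
    exact sum_congr rfl fun i _ => mul_comm _ _
  have hL : (n + 1 : ℝ) * boundedCycleWeight m (n + 1) =
      ∑ p : (n + 1).Partition with ∀ c ∈ p.parts, c ≤ m, ∑ i ∈ range (n + 1),
        ((i : ℝ) + 1) * p.parts.count (i + 1) * ((centralizerOrder p.parts : ℝ))⁻¹ := by
    rw [boundedCycleWeight, mul_sum]
    refine sum_congr rfl fun p _ => ?_
    rw [← sum_mul, ← hsize p]
  rw [hL, sum_comm]
  refine sum_congr rfl fun i hi => ?_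
  rw [← sum_inv_centralizerOrder_erase m n i (Nat.lt_succ_iff.1 (mem_range.1 hi)), ← filter_filter,
    sum_filter (fun p : (n + 1).Partition => i + 1 ∈ p.parts)]
  refine sum_congr rfl fun p _ => ?_
  split_ifs with hmem
  · have h := centralizerOrder_cons (i + 1) (p.parts.erase (i + 1))
    rw [Multiset.cons_erase hmem] at h
    have h2 : (0 : ℝ) < centralizerOrder (p.parts.erase (i + 1)) := by
      exact_mod_cast centralizerOrder_pos fun j hj => p.parts_pos (Multiset.mem_of_mem_erase hj)
    have h3 : (0 : ℝ) < p.parts.count (i + 1) := by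
      exact_mod_cast Multiset.count_pos.2 hmem
    rw [h]
    push_cast
    field_simp
  · rw [Multiset.count_eq_zero_of_notMem hmem]
    simp
-- The two weight sequences and the conclusion
theorem truncated_inv_factorial_logConcave (m i j : ℕ) (hij : i ≤ j) :
    (if i ≤ m then ((i - 1).factorial : ℝ)⁻¹ else 0) *
        (if j + 1 ≤ m then ((j + 1 - 1).factorial : ℝ)⁻¹ else 0) ≤
      (if i + 1 ≤ m then ((i + 1 - 1).factorial : ℝ)⁻¹ else 0) *
        (if j ≤ m then ((j - 1).factorial : ℝ)⁻¹ else 0) := by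
  by_cases hj : j + 1 ≤ m
  · rw [if_pos hj, if_pos (show i ≤ m by omega), if_pos (show i + 1 ≤ m by omega),
      if_pos (show j ≤ m by omega), ← mul_inv, ← mul_inv]
    refine inv_anti₀ (by positivity) ?_
    norm_cast
    rcases i with _ | i
    · simpa using Nat.factorial_le (Nat.sub_le j 1)
    obtain ⟨j, rfl⟩ : ∃ k, j = k + 1 := ⟨j - 1, by omega⟩
    simp only [Nat.add_sub_cancel, Nat.factorial_succ]
    calc (i + 1) * i.factorial * j.factorial
        = (i + 1) * (i.factorial * j.factorial) := by ring
      _ ≤ (j + 1) * (i.factorial * j.factorial) := Nat.mul_le_mul_right _ hij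
      _ = i.factorial * ((j + 1) * j.factorial) := by ring
  · rw [if_neg hj, mul_zero]
    refine mul_nonneg ?_ ?_ <;> split_ifs <;> positivity

theorem truncated_one_logConcave (m i j : ℕ) (hij : i ≤ j) :
    (if i ≤ m then (1 : ℝ) else 0) * (if j + 1 ≤ m then 1 else 0) ≤
      (if i + 1 ≤ m then 1 else 0) * (if j ≤ m then 1 else 0) := by
  by_cases hj : j + 1 ≤ m
  · rw [if_pos hj, if_pos (show i ≤ m by omega), if_pos (show i + 1 ≤ m by omega),
      if_pos (show j ≤ m by omega)]
  · rw [if_neg hj, mul_zero]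
    refine mul_nonneg ?_ ?_ <;> split_ifs <;> positivity

theorem restrictedBell_div_factorial_rec (m n : ℕ) :
    (n + 1 : ℝ) * ((restrictedBell m (n + 1) : ℝ) / (n + 1).factorial) =
      ∑ j ∈ Finset.range (n + 1), (if j + 1 ≤ m then ((j + 1 - 1).factorial : ℝ)⁻¹ else 0) *
        ((restrictedBell m (n - j) : ℝ) / (n - j).factorial) := by
  have h : (n + 1 : ℝ) * ((restrictedBell m (n + 1) : ℝ) / (n + 1).factorial) =
      (restrictedBell m (n + 1) : ℝ) / n.factorial := by
    rw [Nat.factorial_succ]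
    push_cast
    field_simp
  rw [h, restrictedBell_succ]
  push_cast
  rw [Finset.sum_div]
  refine Finset.sum_congr rfl fun j hj => ?_
  rw [Nat.cast_choose ℝ (Nat.lt_succ_iff.1 (Finset.mem_range.1 hj))]
  split_ifs
  · field_simp
  · simp

theorem mainTheorem6 (m : ℕ) :
    (IsLogConvexSeq (fun n : ℕ => (restrictedBell m n : ℝ)) ∧
      IsLogConcaveSeq (fun n : ℕ => (restrictedBell m n : ℝ) / (Nat.factorial n : ℝ))) ∧
    (IsLogConvexSeq (fun n : ℕ => (restrictedFactorial m n : ℝ)) ∧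
      IsLogConcaveSeq (fun n : ℕ => (restrictedFactorial m n : ℝ) / (Nat.factorial n : ℝ))) := by
  constructor
  -- Truncated subtraction makes the value at `j = 0` equal to `1`, as `X 0 = 1` requires.
  · have hX : ∀ j : ℕ, (0 : ℝ) ≤ if j ≤ m then ((j - 1).factorial : ℝ)⁻¹ else 0 := fun j => by
      split_ifs <;> positivity
    have hA0 : (0 : ℝ) < (restrictedBell m 0 : ℝ) / (Nat.factorial 0 : ℝ) := by
      simp [restrictedBell_zero_right]
    have h := isLogConvexSeq_of_exp_recurrence
      (A := fun n => (restrictedBell m n : ℝ) / (Nat.factorial n : ℝ)) hX (by simp)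
      (truncated_inv_factorial_logConcave m) hA0 (restrictedBell_div_factorial_rec m)
    refine ⟨?_, isLogConcaveSeq_of_exp_recurrence hX (by simp)
      (truncated_inv_factorial_logConcave m) hA0 (restrictedBell_div_factorial_rec m)⟩
    convert h using 2 with n
    field_simp
  · have hX : ∀ j : ℕ, (0 : ℝ) ≤ if j ≤ m then 1 else 0 := fun j => by
      split_ifs <;> positivity
    have hA0 : 0 < boundedCycleWeight m 0 := by simp [boundedCycleWeight_zero]
    have hrec : ∀ n : ℕ, (n + 1 : ℝ) * boundedCycleWeight m (n + 1) =
        ∑ j ∈ Finset.range (n + 1), (if j + 1 ≤ m then 1 else 0) * boundedCycleWeight m (n - j) :=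
      fun n => by simpa using boundedCycleWeight_rec m n
    have hdiv : (fun n : ℕ => (restrictedFactorial m n : ℝ) / (Nat.factorial n : ℝ)) =
        boundedCycleWeight m := by
      funext n
      rw [restrictedFactorial_eq]
      field_simp
    rw [hdiv]
    simp only [restrictedFactorial_eq]
    exact ⟨isLogConvexSeq_of_exp_recurrence hX (by simp) (truncated_one_logConcave m) hA0 hrec,
      isLogConcaveSeq_of_exp_recurrence hX (by simp) (truncated_one_logConcave m) hA0 hrec⟩
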